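/- Let $r>0$, $T>0$, and let $f:[0,T]\times\mathbb R\to\mathbb R$ satisfy: (H1) $f(\cdot,x)$ is measurable for every $x\in\mathbb R$, $f(t,\cdot)$ is continuous for a.e. $t\in[0,T]$, and $|f(t,x)|\le m(t)$ for all $(t,x)\in[0,T]\times\mathbb R$, for some $m\in L^1([0,T])$; (H2) there is $\alpha\in L^1([0,T])$ such that for a.e. $t\in[0,T]$, $|f(t,x)-f(t,y)|\le\alpha(t)|x-y|$ for all $x,y\in\mathbb R$. For $v\in\mathbb R$, a solution with initial velocity $v$ of the billiard Cauchy problem in $K=[-r,r]$ is a continuous function $x:[0,T]\to[-r,r]$ with $x(0)=0$, $\dot x(0)=v$, such that: on every time interval $[c,d]\subset[0,T]$ on which $|x|<r$, $x$ has an absolutely continuous derivative and $\ddot x(t)=f(t,x(t))$ for a.e. $t$; and at every $s\in(0,T)$ with $|x(s)|=r$ the one-sided derivatives exist and satisfy $\dot x(s+)=\dot x(s-)+I(\dot x(s-))$ with $I(z)=-2z$, that is, $\dot x(s+)=-\dot x(s-)$. The impact times of $x$ are the $s\in[0,T]$ with $|x(s)|=r$. Let $\|m\|_1=\int_0^T|m(t)|\,dt$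 and let $b>\|m\|_1$. Then for every $v>\|m\|_1$ there is exactly one solution $x_v$ on $[0,T]$ with initial velocity $v$, and the endpoint map $v\mapsto x_v(T)\in[-r,r]$ is continuous at $b$. Moreover, $x_b$ has only finitely many impact times $t_1(b)<\dots<t_k(b)$ ($k\ge 0$), and they depend continuously on the initial velocity: for every $\eta>0$ there is $\delta>0$ such that for every $v$ with $|v-b|<\delta$, the solution $x_v$ has exactly $j$ impact times $t_1(v)<\dots<t_j(v)$, where $j=k$ or, only in the case $|x_b(T)|=r$, possibly $j=k-1$; and $|t_i(v)-t_i(b)|<\eta$ for $i=1,\dots,j$. -/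

import Mathlib

open Set Filter Topology MeasureTheory

/-- `f` is a Carathéodory function on `[0, T] × ℝ` that is bounded by the function
`m ∈ L¹([0, T])`. (`AEMeasurable` with respect to Lebesgue measure on `[0, T]` is the same as
Lebesgue measurable.) -/
structure IsIntegrablyBoundedCaratheodory (T : ℝ) (f : ℝ → ℝ → ℝ) (m : ℝ → ℝ) : Prop where
  measurable : ∀ x : ℝ, AEMeasurable (fun t => f t x) (volume.restrict (Icc 0 T))
  continuous : ∀ᵐ t : ℝ, t ∈ Icc 0 T → Continuous (fun x => f t x)
  integrableOn : IntegrableOn m (Icc 0 T)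
  bound : ∀ t ∈ Icc 0 T, ∀ x : ℝ, |f t x| ≤ m t

/-- `f` is Lipschitz in the second variable with a constant `α(t)`, where `α ∈ L¹([0, T])`. -/
structure IsIntegrablyLipschitz (T : ℝ) (f : ℝ → ℝ → ℝ) (α : ℝ → ℝ) : Prop where
  integrableOn : IntegrableOn α (Icc 0 T)
  lipschitz : ∀ᵐ t : ℝ, t ∈ Icc 0 T → ∀ x y : ℝ, |f t x - f t y| ≤ α t * |x - y|

/-- The impulse function of the one-dimensional billiard: with `x'(s+) = x'(s) + I(x'(s))`
the velocity is reversed at an impact. -/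
def impulse (z : ℝ) : ℝ := -2 * z

/-- `x` restricted to `[0, T]` is a solution with values in `K = [-r, r]` of the impulsive Cauchy
problem `x'' = f(t, x)` while `x(t) ∈ int K`, `x'(s+) = x'(s) + I(x'(s))` if `x(s) ∈ ∂K`,
`x(0) = 0`, `x'(0) = v`. Only the values of `x` on `[0, T]` matter. -/
structure IsBilliardSolution (r T : ℝ) (f : ℝ → ℝ → ℝ) (v : ℝ) (x : ℝ → ℝ) : Prop where
  continuousOn : ContinuousOn x (Icc 0 T)
  mem_table : ∀ t ∈ Icc 0 T, x t ∈ Icc (-r) r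
  /-- On every time interval `[c, d]` on which `x` is in the interior of the table, `x` has an
  absolutely continuous derivative `w`, and `w' = f(t, x(t))` almost everywhere. -/
  motion : ∀ c d : ℝ, 0 ≤ c → c < d → d ≤ T → (∀ t ∈ Icc c d, x t ∈ Ioo (-r) r) →
    ∃ w : ℝ → ℝ, AbsolutelyContinuousOnInterval w c d ∧
      (∀ t ∈ Icc c d, HasDerivWithinAt x (w t) (Icc c d) t) ∧
      ∀ᵐ t : ℝ, t ∈ Ioo c d → HasDerivAt w (f t (x t)) t
  /-- At an impact the incoming velocity `p` (derivative from the left) and the outgoing velocity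
  (derivative from the right) exist and satisfy the impact law. -/
  impact : ∀ s ∈ Ioo 0 T, (x s = r ∨ x s = -r) →
    ∃ p : ℝ, HasDerivWithinAt x p (Iic s) s ∧ HasDerivWithinAt x (p + impulse p) (Ici s) s
  initial_position : x 0 = 0
  initial_velocity : HasDerivWithinAt x v (Ici 0) 0

/-- The times in `[0, T]` at which `x` is on the boundary of `[-r, r]` are exactly
`t 1 < t 2 < ⋯ < t k`. -/
def HasImpactTimes (r T : ℝ) (x : ℝ → ℝ) (k : ℕ) (t : ℕ → ℝ) : Prop :=
  StrictMonoOn t (Icc 1 k) ∧ t '' Icc 1 k = {s ∈ Icc 0 T | x s = r ∨ x s = -r}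

/-! Reflecting the table instead of the velocity unfolds the billiard. If `Y'' = foldSign r Y * g t
(fold r Y)`, with `Y 0 = 0` and `Y' 0 = v`, then `fold r ∘ Y` is a billiard path whose impacts are
the crossings of odd multiples of `r` by `Y`. As `v > ‖m‖₁`, the velocity of `Y` is at least `v -
‖m‖₁ > 0`, so `Y` is strictly increasing: impacts are transversal, finite in number on `[0, T]`, and
move continuously when `Y` does.

The unfolded force jumps at odd multiples of `r`, so no Lipschitz argument applies to it directly.
An injective path meets these points only on a null set of times, which is enough for dominated
convergence; with Arzelà–Ascoli, approximate solutions subconverge to a solution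
(`exists_subseq_tendsto`). This gives existence through delayed equations and, once uniqueness is
known, continuous dependence on `v`.

Uniqueness is proved downstairs, where the force is Lipschitz: two billiard paths that agree up to
some time have the same nonzero outgoing velocity there, are both interior just afterwards, and
agree a little longer (`exists_gt_eqOn`). It is then lifted back to `Y` (`IsUnfoldedSolution.eq`).
-/

/-! ### The folding map and its one-sided derivatives -/

/-- The triangle wave that folds the line onto `[-r, r]`; it is the identity on `[-r, r]` and is
reflected at the odd multiples of `r`. -/
noncomputable def fold (r y : ℝ) : ℝ :=
  2 * r / Real.pi * Real.arcsin (Real.sin (Real.pi / (2 * r) * y))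

open Classical in
/-- The slope of `fold r`. -/
noncomputable def foldSign (r y : ℝ) : ℝ := if 0 < Real.cos (Real.pi / (2 * r) * y) then 1 else -1

lemma continuous_fold (r : ℝ) : Continuous (fold r) := by
  unfold fold
  exact continuous_const.mul (Real.continuous_arcsin.comp (Real.continuous_sin.comp (by fun_prop)))

lemma measurable_foldSign (r : ℝ) : Measurable (foldSign r) := by
  unfold foldSign
  exact Measurable.ite (measurableSet_lt measurable_const (by fun_prop)) measurable_const
    measurable_const

lemma foldSign_mul_self (r y : ℝ) : foldSign r y * foldSign r y = 1 := by
  unfold foldSign; split_ifs <;> norm_num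

lemma abs_foldSign (r y : ℝ) : |foldSign r y| = 1 := by
  unfold foldSign; split_ifs <;> norm_num

lemma neg_one_zpow_eq_or (n : ℤ) : (-1 : ℝ) ^ n = 1 ∨ (-1 : ℝ) ^ n = -1 := by
  rcases Int.even_or_odd n with h | h
  · exact Or.inl h.neg_one_zpow
  · exact Or.inr h.neg_one_zpow

lemma pi_div_mul_eq {r : ℝ} (hr : 0 < r) (y : ℝ) (n : ℤ) :
    Real.pi / (2 * r) * y = Real.pi / (2 * r) * (y - 2 * r * n) + n * Real.pi := by
  field_simp; ring

lemma abs_pi_div_mul_le {r z : ℝ} (hr : 0 < r) (h : |z| ≤ r) :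
    |Real.pi / (2 * r) * z| ≤ Real.pi / 2 := by
  rw [abs_mul, abs_of_pos (by positivity)]
  calc Real.pi / (2 * r) * |z| ≤ Real.pi / (2 * r) * r := by gcongr
    _ = _ := by field_simp

lemma abs_pi_div_mul_lt {r z : ℝ} (hr : 0 < r) (h : |z| < r) :
    |Real.pi / (2 * r) * z| < Real.pi / 2 := by
  rw [abs_mul, abs_of_pos (by positivity)]
  calc Real.pi / (2 * r) * |z| < Real.pi / (2 * r) * r := by gcongr
    _ = _ := by field_simp

lemma fold_eq {r : ℝ} (hr : 0 < r) {y : ℝ} {n : ℤ} (h : |y - 2 * r * n| ≤ r) :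
    fold r y = (-1) ^ n * (y - 2 * r * n) := by
  have h1 := abs_le.1 (abs_pi_div_mul_le hr h)
  unfold fold
  rw [pi_div_mul_eq hr y n, Real.sin_add_int_mul_pi]
  rcases neg_one_zpow_eq_or n with hn | hn <;> rw [hn]
  · rw [one_mul, Real.arcsin_sin (by linarith) h1.2]; field_simp
  · rw [neg_one_mul, Real.arcsin_neg, Real.arcsin_sin (by linarith) h1.2]; field_simp

lemma foldSign_eq {r : ℝ} (hr : 0 < r) {y : ℝ} {n : ℤ} (h : |y - 2 * r * n| < r) :
    foldSign r y = (-1) ^ n := by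
  have h1 := abs_lt.1 (abs_pi_div_mul_lt hr h)
  have h2 := Real.cos_pos_of_mem_Ioo ⟨by linarith, h1.2⟩
  unfold foldSign
  rw [pi_div_mul_eq hr y n, Real.cos_add_int_mul_pi]
  rcases neg_one_zpow_eq_or n with hn | hn <;> rw [hn]
  · rw [if_pos (by linarith)]
  · rw [if_neg (by linarith)]

lemma exists_abs_sub_le {r : ℝ} (hr : 0 < r) (y : ℝ) : ∃ n : ℤ, |y - 2 * r * n| ≤ r := by
  refine ⟨round (y / (2 * r)), ?_⟩
  have h := abs_sub_round (y / (2 * r))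
  have : y - 2 * r * round (y / (2 * r)) = 2 * r * (y / (2 * r) - round (y / (2 * r))) := by
    field_simp
  rw [this, abs_mul, abs_of_pos (by positivity)]
  nlinarith

lemma abs_fold {r : ℝ} (hr : 0 < r) {y : ℝ} {n : ℤ} (h : |y - 2 * r * n| ≤ r) :
    |fold r y| = |y - 2 * r * n| := by
  rw [fold_eq hr h, abs_mul]
  rcases neg_one_zpow_eq_or n with hn | hn <;> simp [hn]

lemma abs_fold_le {r : ℝ} (hr : 0 < r) (y : ℝ) : |fold r y| ≤ r := by
  obtain ⟨n, hn⟩ := exists_abs_sub_le hr y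
  rwa [abs_fold hr hn]

lemma fold_zero (r : ℝ) : fold r 0 = 0 := by simp [fold]

lemma abs_fold_eq_iff {r : ℝ} (hr : 0 < r) (y : ℝ) :
    |fold r y| = r ↔ ∃ n : ℤ, y = 2 * r * n - r := by
  constructor
  · intro h
    obtain ⟨n, hn⟩ := exists_abs_sub_le hr y
    rw [abs_fold hr hn] at h
    rcases (abs_eq hr.le).1 h with h | h
    · exact ⟨n + 1, by push_cast; linarith⟩
    · exact ⟨n, by linarith⟩
  · rintro ⟨n, rfl⟩
    have : |2 * r * n - r - 2 * r * n| = r := by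
      rw [show 2 * r * n - r - 2 * r * n = -r by ring, abs_neg, abs_of_pos hr]
    rw [abs_fold hr this.le, this]

lemma eventually_abs_sub_mul_lt {r y : ℝ} {n : ℤ} (h : |y - 2 * r * n| < r) :
    ∀ᶠ z in 𝓝 y, |z - 2 * r * n| < r :=
  (Continuous.continuousAt (by fun_prop)).eventually_lt continuousAt_const h

lemma hasDerivAt_fold {r : ℝ} (hr : 0 < r) {y : ℝ} (h : |fold r y| < r) :
    HasDerivAt (fold r) (foldSign r y) y := by
  obtain ⟨n, hn⟩ := exists_abs_sub_le hr y
  have hn' : |y - 2 * r * n| < r := by rwa [abs_fold hr hn] at h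
  rw [foldSign_eq hr hn']
  have : HasDerivAt (fun z : ℝ => (-1 : ℝ) ^ n * (z - 2 * r * n)) ((-1) ^ n) y := by
    simpa using ((hasDerivAt_id y).sub_const (2 * r * n)).const_mul ((-1 : ℝ) ^ n)
  refine this.congr_of_eventuallyEq ?_
  filter_upwards [eventually_abs_sub_mul_lt hn'] with z hz using fold_eq hr hz.le

lemma continuousAt_foldSign {r : ℝ} (hr : 0 < r) {y : ℝ} (h : |fold r y| < r) :
    ContinuousAt (foldSign r) y := by
  obtain ⟨n, hn⟩ := exists_abs_sub_le hr y
  have hn' : |y - 2 * r * n| < r := by rwa [abs_fold hr hn] at h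
  refine continuousAt_const.congr (f := fun _ => (-1 : ℝ) ^ n) ?_
  filter_upwards [eventually_abs_sub_mul_lt hn'] with z hz using (foldSign_eq hr hz).symm

lemma hasDerivWithinAt_fold_Iic {r : ℝ} (hr : 0 < r) (n : ℤ) :
    HasDerivWithinAt (fold r) ((-1) ^ n) (Iic (2 * r * n + r)) (2 * r * n + r) := by
  have : HasDerivAt (fun z : ℝ => (-1 : ℝ) ^ n * (z - 2 * r * n)) ((-1) ^ n) (2 * r * n + r) := by
    simpa using ((hasDerivAt_id _).sub_const (2 * r * n)).const_mul ((-1 : ℝ) ^ n)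
  refine this.hasDerivWithinAt.congr_of_eventuallyEq ?_ (fold_eq hr (by simp [abs_of_pos hr]))
  have : Ioi (2 * r * n) ∈ 𝓝 (2 * r * n + r) := Ioi_mem_nhds (by linarith)
  filter_upwards [self_mem_nhdsWithin, mem_nhdsWithin_of_mem_nhds this] with z hz hz'
  rw [mem_Iic] at hz
  rw [mem_Ioi] at hz'
  exact fold_eq hr (abs_le.2 ⟨by linarith, by linarith⟩)

lemma hasDerivWithinAt_fold_Ici {r : ℝ} (hr : 0 < r) (n : ℤ) :
    HasDerivWithinAt (fold r) ((-1) ^ n) (Ici (2 * r * n - r)) (2 * r * n - r) := by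
  have : HasDerivAt (fun z : ℝ => (-1 : ℝ) ^ n * (z - 2 * r * n)) ((-1) ^ n) (2 * r * n - r) := by
    simpa using ((hasDerivAt_id _).sub_const (2 * r * n)).const_mul ((-1 : ℝ) ^ n)
  refine this.hasDerivWithinAt.congr_of_eventuallyEq ?_
    (fold_eq hr (by rw [abs_le]; constructor <;> linarith))
  have : Iio (2 * r * n) ∈ 𝓝 (2 * r * n - r) := Iio_mem_nhds (by linarith)
  filter_upwards [self_mem_nhdsWithin, mem_nhdsWithin_of_mem_nhds this] with z hz hz'
  rw [mem_Ici] at hz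
  rw [mem_Iio] at hz'
  exact fold_eq hr (abs_le.2 ⟨by linarith, by linarith⟩)

/-! ### Regularising the force -/

/-- A jointly measurable force on `ℝ × ℝ`, everywhere bounded by an integrable function of time
and everywhere Lipschitz in space with an integrable constant, that vanishes off `[0, T]`. -/
structure IsRegularForce (T : ℝ) (g : ℝ → ℝ → ℝ) (M A : ℝ → ℝ) : Prop where
  measurable : Measurable (Function.uncurry g)
  continuous : ∀ t, Continuous (g t)
  bound : ∀ t x, |g t x| ≤ M t
  lipschitz : ∀ t x y, |g t x - g t y| ≤ A t * |x - y|
  integrable_bound : Integrable M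
  integrable_lipschitz : Integrable A
  bound_eq_zero : ∀ t ∉ Icc 0 T, M t = 0

/-- All almost-everywhere hypotheses, and the measurable versions of `f · q` for rational `q`, hold
simultaneously off one measurable null set; setting the force to zero there and off `[0, T]` makes
them hold everywhere. Density of the rationals and continuity in space then give joint
measurability. -/
lemma exists_isRegularForce {T : ℝ} {f : ℝ → ℝ → ℝ} {m α : ℝ → ℝ}
    (hf : IsIntegrablyBoundedCaratheodory T f m) (hL : IsIntegrablyLipschitz T f α) :
    ∃ g A, IsRegularForce T g ((Icc 0 T).indicator fun t => |m t|) A ∧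
      ∀ᵐ t : ℝ, t ∈ Icc 0 T → ∀ x, f t x = g t x := by
  classical
  let φ : ℚ → ℝ → ℝ := fun q => (hf.measurable q).mk (fun t => f t q)
  have hφ : ∀ᵐ t : ℝ, ∀ q : ℚ, t ∈ Icc 0 T → f t q = φ q t :=
    ae_all_iff.2 fun q => (ae_restrict_iff' measurableSet_Icc).1 (hf.measurable q).ae_eq_mk
  have hgood : ∀ᵐ t : ℝ, t ∈ Icc 0 T → Continuous (f t) ∧
      (∀ x y, |f t x - f t y| ≤ α t * |x - y|) ∧ ∀ q : ℚ, f t q = φ q t := by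
    filter_upwards [hφ, hf.continuous, hL.lipschitz] with t h1 h2 h3 ht
    exact ⟨h2 ht, h3 ht, fun q => h1 q ht⟩
  obtain ⟨N, hNs, hNm, hN0⟩ := exists_measurable_superset_of_null (ae_iff.1 hgood)
  let G := Nᶜ
  have hGm : MeasurableSet G := hNm.compl
  have hG : ∀ᵐ t : ℝ, t ∈ G := measure_eq_zero_iff_ae_notMem.1 hN0
  have hGs : ∀ t ∈ G, t ∈ Icc 0 T → Continuous (f t) ∧
      (∀ x y, |f t x - f t y| ≤ α t * |x - y|) ∧ ∀ q : ℚ, f t q = φ q t := fun t ht =>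
    not_not.1 fun h => ht (hNs h)
  let g : ℝ → ℝ → ℝ := fun t x => (G ∩ Icc 0 T).indicator (fun t => f t x) t
  have hS : MeasurableSet (G ∩ Icc 0 T) := hGm.inter measurableSet_Icc
  have hin : ∀ t ∈ G ∩ Icc 0 T, g t = f t := fun t ht => by
    ext x; exact indicator_of_mem ht _
  have hout : ∀ t, t ∉ G ∩ Icc 0 T → g t = 0 := fun t ht => by
    ext x; exact indicator_of_notMem ht _
  have hcont : ∀ t, Continuous (g t) := by
    intro t
    by_cases ht : t ∈ G ∩ Icc 0 T
    · rw [hin t ht]; exact (hGs t ht.1 ht.2).1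
    · rw [hout t ht]; exact continuous_const
  have hmeasq : ∀ q : ℚ, Measurable fun t => g t q := by
    intro q
    have : (fun t => g t q) = (G ∩ Icc 0 T).indicator (φ q) := by
      ext t
      by_cases ht : t ∈ G ∩ Icc 0 T
      · rw [hin t ht, indicator_of_mem ht]; exact (hGs t ht.1 ht.2).2.2 q
      · rw [hout t ht, indicator_of_notMem ht]; rfl
    rw [this]
    exact (hf.measurable q).measurable_mk.indicator hS
  have hmeas : ∀ x, Measurable fun t => g t x := by
    intro x
    obtain ⟨u, hu, hux⟩ := mem_closure_iff_seq_limit.1 (Rat.denseRange_cast (𝕜 := ℝ) x)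
    choose q hq using hu
    refine measurable_of_tendsto_metrizable (fun n => hmeasq (q n)) (tendsto_pi_nhds.2 fun t => ?_)
    simp only [hq]
    exact ((hcont t).tendsto x).comp hux
  refine ⟨g, (Icc 0 T).indicator fun t => |α t|, ⟨?_, hcont, ?_, ?_, ?_, ?_, ?_⟩, ?_⟩
  · have := measurable_uncurry_of_continuous_of_measurable (u := fun x t => g t x) hcont hmeas
    exact this.comp measurable_swap
  · intro t x
    by_cases ht : t ∈ G ∩ Icc 0 T
    · rw [hin t ht, indicator_of_mem ht.2]
      exact (hf.bound t ht.2 x).trans (le_abs_self _)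
    · rw [hout t ht]
      simpa using indicator_nonneg (fun t _ => abs_nonneg (m t)) t
  · intro t x y
    by_cases ht : t ∈ G ∩ Icc 0 T
    · rw [hin t ht, indicator_of_mem ht.2]
      exact ((hGs t ht.1 ht.2).2.1 x y).trans (by gcongr; exact le_abs_self _)
    · rw [hout t ht]
      have := indicator_nonneg (s := Icc 0 T) (fun t _ => abs_nonneg (α t)) t
      simpa using mul_nonneg this (abs_nonneg (x - y))
  · exact IntegrableOn.integrable_indicator hf.integrableOn.abs measurableSet_Icc
  · exact IntegrableOn.integrable_indicator hL.integrableOn.abs measurableSet_Icc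
  · intro t ht
    exact indicator_of_notMem ht _
  · filter_upwards [hG] with t ht ht' x
    rw [hin t ⟨ht, ht'⟩]

/-! ### The unfolded equation in integral form -/

/-- The force acting on the unfolded trajectory. -/
noncomputable def unfoldedForce (r : ℝ) (g : ℝ → ℝ → ℝ) (t y : ℝ) : ℝ :=
  foldSign r y * g t (fold r y)

/-- The velocity at time `t` produced by the unfolded force along the path `u`. -/
noncomputable def unfoldedVelocity (r : ℝ) (g : ℝ → ℝ → ℝ) (v : ℝ) (u : ℝ → ℝ) (t : ℝ) : ℝ :=
  v + ∫ s in (0)..t, unfoldedForce r g s (u s)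

/-- The position at time `t` produced by the unfolded force along the path `u`. -/
noncomputable def unfoldedPosition (r : ℝ) (g : ℝ → ℝ → ℝ) (v : ℝ) (u : ℝ → ℝ) (t : ℝ) : ℝ :=
  ∫ s in (0)..t, unfoldedVelocity r g v u s

/-- An injective path is off the boundary at almost all times. -/
lemma ae_abs_fold_comp_lt {r : ℝ} (hr : 0 < r) {u : ℝ → ℝ} (hinj : Function.Injective u) :
    ∀ᵐ s, |fold r (u s)| < r := by
  have hc : (u ⁻¹' {y | |fold r y| = r}).Countable := by
    refine Countable.preimage_of_injOn ?_ hinj.injOn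
    refine (countable_range fun n : ℤ => 2 * r * n - r).mono fun y hy => ?_
    obtain ⟨n, hn⟩ := (abs_fold_eq_iff hr y).1 hy
    exact ⟨n, hn.symm⟩
  filter_upwards [measure_eq_zero_iff_ae_notMem.1 (hc.measure_zero volume)] with s hs
  exact lt_of_le_of_ne (abs_fold_le hr _) hs

namespace IsRegularForce

variable {r T v : ℝ} {g : ℝ → ℝ → ℝ} {M A u : ℝ → ℝ}

lemma measurable_comp (hg : IsRegularForce T g M A) (hu : Continuous u) :
    Measurable fun s => g s (u s) :=
  hg.measurable.comp (measurable_id.prodMk hu.measurable)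

lemma integrable_comp (hg : IsRegularForce T g M A) (hu : Continuous u) :
    Integrable fun s => g s (u s) :=
  hg.integrable_bound.mono' (hg.measurable_comp hu).aestronglyMeasurable
    (Eventually.of_forall fun s => hg.bound s _)

lemma eq_zero (hg : IsRegularForce T g M A) {t : ℝ} (ht : t ∉ Icc 0 T) (x : ℝ) : g t x = 0 :=
  abs_nonpos_iff.1 ((hg.bound t x).trans (hg.bound_eq_zero t ht).le)

lemma abs_unfoldedForce_le (hg : IsRegularForce T g M A) (t y : ℝ) :
    |unfoldedForce r g t y| ≤ M t := by
  rw [unfoldedForce, abs_mul, abs_foldSign, one_mul]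
  exact hg.bound _ _

lemma unfoldedForce_eq_zero (hg : IsRegularForce T g M A) {t : ℝ} (ht : t ∉ Icc 0 T) (y : ℝ) :
    unfoldedForce r g t y = 0 := by
  rw [unfoldedForce, hg.eq_zero ht, mul_zero]

lemma aestronglyMeasurable_unfoldedForce (hg : IsRegularForce T g M A) (hu : Continuous u)
    (μ : Measure ℝ) : AEStronglyMeasurable (fun s => unfoldedForce r g s (u s)) μ :=
  (((measurable_foldSign r).comp hu.measurable).mul
    (hg.measurable_comp ((continuous_fold r).comp hu))).aestronglyMeasurable

lemma integrable_unfoldedForce (hg : IsRegularForce T g M A) (hu : Continuous u) :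
    Integrable fun s => unfoldedForce r g s (u s) :=
  hg.integrable_bound.mono' (hg.aestronglyMeasurable_unfoldedForce hu _)
    (Eventually.of_forall fun s => hg.abs_unfoldedForce_le s _)

lemma bound_nonneg (hg : IsRegularForce T g M A) (t : ℝ) : 0 ≤ M t :=
  (abs_nonneg _).trans (hg.bound t 0)

lemma abs_unfoldedVelocity_sub_le (hg : IsRegularForce T g M A) (t : ℝ) :
    |unfoldedVelocity r g v u t - v| ≤ ∫ s, M s := by
  rw [unfoldedVelocity, add_sub_cancel_left]
  calc _ ≤ ∫ s in uIoc 0 t, M s := by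
        rw [← Real.norm_eq_abs, intervalIntegral.norm_integral_eq_norm_integral_uIoc]
        exact norm_integral_le_of_norm_le hg.integrable_bound.integrableOn
          (Eventually.of_forall fun s => hg.abs_unfoldedForce_le s _)
    _ ≤ _ := setIntegral_le_integral hg.integrable_bound (Eventually.of_forall hg.bound_nonneg)

lemma continuous_unfoldedVelocity (hg : IsRegularForce T g M A) (hu : Continuous u) :
    Continuous (unfoldedVelocity r g v u) :=
  continuous_const.add (intervalIntegral.continuous_primitive
    (fun _ _ => (hg.integrable_unfoldedForce hu).intervalIntegrable) 0)

lemma hasDerivAt_unfoldedPosition (hg : IsRegularForce T g M A) (hu : Continuous u) (t : ℝ) :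
    HasDerivAt (unfoldedPosition r g v u) (unfoldedVelocity r g v u t) t :=
  intervalIntegral.integral_hasDerivAt_right
    ((hg.continuous_unfoldedVelocity hu).intervalIntegrable _ _)
    (hg.continuous_unfoldedVelocity hu).aestronglyMeasurable.stronglyMeasurableAtFilter
    (hg.continuous_unfoldedVelocity hu).continuousAt

lemma unfoldedPosition_zero : unfoldedPosition r g v u 0 = 0 := by simp [unfoldedPosition]

lemma continuous_unfoldedPosition (hg : IsRegularForce T g M A) (hu : Continuous u) :
    Continuous (unfoldedPosition r g v u) :=
  continuous_iff_continuousAt.2 fun t => (hg.hasDerivAt_unfoldedPosition hu t).continuousAt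

/-- The slope bound does not depend on the path `u`, so it survives limits of approximate solutions
and keeps them injective. -/
lemma mul_sub_le_unfoldedPosition_sub (hg : IsRegularForce T g M A) (hu : Continuous u)
    {s t : ℝ} (hst : s ≤ t) :
    (v - ∫ s, M s) * (t - s) ≤ unfoldedPosition r g v u t - unfoldedPosition r g v u s := by
  refine mul_sub_le_image_sub_of_le_deriv
    (fun t => (hg.hasDerivAt_unfoldedPosition hu t).differentiableAt) (fun t => ?_) hst
  rw [(hg.hasDerivAt_unfoldedPosition hu t).deriv]
  linarith [(abs_le.1 (hg.abs_unfoldedVelocity_sub_le (r := r) (v := v) (u := u) t)).1]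

lemma lipschitzWith_unfoldedPosition (hg : IsRegularForce T g M A) (hu : Continuous u) {C : NNReal}
    (hC : |v| + ∫ s, M s ≤ C) : LipschitzWith C (unfoldedPosition r g v u) := by
  refine lipschitzWith_of_nnnorm_deriv_le
    (fun t => (hg.hasDerivAt_unfoldedPosition hu t).differentiableAt) (fun t => ?_)
  rw [(hg.hasDerivAt_unfoldedPosition hu t).deriv, ← NNReal.coe_le_coe, coe_nnnorm,
    Real.norm_eq_abs]
  have h1 := hg.abs_unfoldedVelocity_sub_le (r := r) (v := v) (u := u) t
  have h2 := abs_sub_abs_le_abs_sub (unfoldedVelocity r g v u t) v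
  linarith

/-- If `u n` converges to an injective path pointwise on `[0, T]`, then the velocities produced
along `u n` converge. -/
lemma tendsto_unfoldedVelocity (hg : IsRegularForce T g M A) (hr : 0 < r) {V : ℕ → ℝ}
    (hV : Tendsto V atTop (𝓝 v)) {U : ℕ → ℝ → ℝ} (hU : ∀ n, Continuous (U n))
    (hUu : ∀ t ∈ Icc 0 T, Tendsto (fun n => U n t) atTop (𝓝 (u t)))
    (hinj : Function.Injective u) (t : ℝ) :
    Tendsto (fun n => unfoldedVelocity r g (V n) (U n) t) atTop
      (𝓝 (unfoldedVelocity r g v u t)) := by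
  refine hV.add (intervalIntegral.tendsto_integral_filter_of_dominated_convergence M
    (Eventually.of_forall fun n => hg.aestronglyMeasurable_unfoldedForce (hU n) _)
    (Eventually.of_forall fun n => Eventually.of_forall fun s _ => hg.abs_unfoldedForce_le s _)
    hg.integrable_bound.intervalIntegrable ?_)
  -- The integrand can fail to converge only when the limit path sits at a jump of `foldSign`, which
  -- happens on a null set of times.
  filter_upwards [ae_abs_fold_comp_lt hr hinj] with s hlt _
  by_cases hsT : s ∈ Icc 0 T
  · have hcont : ContinuousAt (unfoldedForce r g s) (u s) :=
      (continuousAt_foldSign hr hlt).mul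
        ((hg.continuous s).comp (continuous_fold r)).continuousAt
    exact hcont.tendsto.comp (hUu s hsT)
  · simp only [hg.unfoldedForce_eq_zero hsT]
    exact tendsto_const_nhds

lemma tendsto_unfoldedPosition (hg : IsRegularForce T g M A) (hr : 0 < r) {V : ℕ → ℝ}
    (hV : Tendsto V atTop (𝓝 v)) {U : ℕ → ℝ → ℝ} (hU : ∀ n, Continuous (U n))
    (hUu : ∀ t ∈ Icc 0 T, Tendsto (fun n => U n t) atTop (𝓝 (u t)))
    (hinj : Function.Injective u) (t : ℝ) :
    Tendsto (fun n => unfoldedPosition r g (V n) (U n) t) atTop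
      (𝓝 (unfoldedPosition r g v u t)) := by
  obtain ⟨B, hB⟩ := hV.abs.bddAbove_range
  refine intervalIntegral.tendsto_integral_filter_of_dominated_convergence
    (fun _ => B + ∫ s, M s)
    (Eventually.of_forall fun n => (hg.continuous_unfoldedVelocity (hU n)).aestronglyMeasurable)
    (Eventually.of_forall fun n => Eventually.of_forall fun s _ => ?_)
    (continuous_const.intervalIntegrable _ _)
    (Eventually.of_forall fun s _ => hg.tendsto_unfoldedVelocity hr hV hU hUu hinj s)
  have h1 := hg.abs_unfoldedVelocity_sub_le (r := r) (v := V n) (u := U n) s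
  have h2 := abs_sub_abs_le_abs_sub (unfoldedVelocity r g (V n) (U n) s) (V n)
  have h3 : |V n| ≤ B := hB ⟨n, rfl⟩
  rw [Real.norm_eq_abs]
  linarith

end IsRegularForce

/-! ### Compactness and existence of unfolded solutions -/

lemma isCompact_setOf_lipschitzWith (C : NNReal) :
    IsCompact {y : C(ℝ, ℝ) | LipschitzWith C y ∧ y 0 = 0} := by
  refine ArzelaAscoli.isCompact_of_equicontinuous _ ?_ ?_
  · have himage : ContinuousMap.toFun '' {y : C(ℝ, ℝ) | LipschitzWith C y ∧ y 0 = 0} =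
        {y : ℝ → ℝ | LipschitzWith C y ∧ y 0 = 0} := by
      ext y
      constructor
      · rintro ⟨y, hy, rfl⟩; exact hy
      · intro hy; exact ⟨⟨y, hy.1.continuous⟩, hy, rfl⟩
    rw [himage]
    refine (isCompact_univ_pi fun t : ℝ =>
      isCompact_Icc (a := -((C : ℝ) * |t|)) (b := C * |t|)).of_isClosed_subset ?_ ?_
    · have h1 : IsClosed {y : ℝ → ℝ | LipschitzWith C y} := by
        simp only [lipschitzWith_iff_dist_le_mul, ofPred_forall]
        exact isClosed_iInter fun s => isClosed_iInter fun t =>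
          isClosed_le ((continuous_apply s).dist (continuous_apply t)) continuous_const
      exact h1.inter (isClosed_eq (continuous_apply 0) continuous_const)
    · rintro y ⟨hy, hy0⟩ t -
      have := hy.dist_le_mul t 0
      rw [hy0, Real.dist_eq, Real.dist_eq, sub_zero, sub_zero] at this
      exact abs_le.1 this
  · exact (LipschitzWith.uniformEquicontinuous _ C fun y => y.2.1).equicontinuous

/-- The unfolded trajectories: `Y'' = unfoldedForce r g t Y`, `Y 0 = 0`, `Y' 0 = v`. -/
def IsUnfoldedSolution (r : ℝ) (g : ℝ → ℝ → ℝ) (v : ℝ) (Y : C(ℝ, ℝ)) : Prop :=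
  ∀ t, Y t = unfoldedPosition r g v Y t

namespace IsRegularForce

variable {r T v : ℝ} {g : ℝ → ℝ → ℝ} {M A u : ℝ → ℝ}

/-- Approximate unfolded solutions subconverge to an unfolded solution. -/
lemma exists_subseq_tendsto (hg : IsRegularForce T g M A) (hr : 0 < r) {V : ℕ → ℝ}
    (hV : Tendsto V atTop (𝓝 v)) (hv : ∫ s, M s < v) {U : ℕ → ℝ → ℝ}
    (hU : ∀ n, Continuous (U n)) {Y : ℕ → C(ℝ, ℝ)}
    (hY : ∀ n t, Y n t = unfoldedPosition r g (V n) (U n) t)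
    (hUY : ∀ t ∈ Icc 0 T, Tendsto (fun n => U n t - Y n t) atTop (𝓝 0)) :
    ∃ (Z : C(ℝ, ℝ)) (φ : ℕ → ℕ), StrictMono φ ∧ Tendsto (fun n => Y (φ n)) atTop (𝓝 Z) ∧
      IsUnfoldedSolution r g v Z := by
  obtain ⟨B, hB⟩ := hV.abs.bddAbove_range
  have hYf : ∀ n, (Y n : ℝ → ℝ) = unfoldedPosition r g (V n) (U n) := fun n => funext (hY n)
  have hmem : ∀ n, Y n ∈ {y : C(ℝ, ℝ) | LipschitzWith (B + ∫ s, M s).toNNReal y ∧ y 0 = 0} := by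
    intro n
    refine ⟨?_, by rw [hY, unfoldedPosition_zero]⟩
    rw [hYf]
    refine hg.lipschitzWith_unfoldedPosition (hU n) ((add_le_add_left (hB ⟨n, rfl⟩) _).trans ?_)
    exact Real.le_coe_toNNReal _
  obtain ⟨Z, -, φ, hφ, hZ⟩ := (isCompact_setOf_lipschitzWith _).tendsto_subseq hmem
  have hpt : ∀ t, Tendsto (fun n => Y (φ n) t) atTop (𝓝 (Z t)) := fun t =>
    ((continuous_eval_const t).tendsto Z).comp hZ
  have hVφ := hV.comp hφ.tendsto_atTop
  have hgrow : ∀ s t, s < t → Z s < Z t := by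
    intro s t hst
    have h1 : (v - ∫ s, M s) * (t - s) ≤ Z t - Z s := by
      refine le_of_tendsto_of_tendsto ((hVφ.sub_const _).mul_const _) ((hpt t).sub (hpt s))
        (Eventually.of_forall fun n => ?_)
      simp only [hY]
      exact hg.mul_sub_le_unfoldedPosition_sub (hU _) hst.le
    nlinarith
  have hinj : Function.Injective Z := StrictMono.injective fun s t => hgrow s t
  refine ⟨Z, φ, hφ, hZ, fun t => tendsto_nhds_unique (hpt t) ?_⟩
  simp only [hY]
  refine hg.tendsto_unfoldedPosition hr hVφ (fun n => hU (φ n)) (fun s hs => ?_) hinj t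
  simpa using ((hUY s hs).comp hφ.tendsto_atTop).add (hpt s)

/-- Existence, by delaying the argument of the force (Tonelli). -/
lemma exists_isUnfoldedSolution (hg : IsRegularForce T g M A) (hr : 0 < r)
    (hv : ∫ s, M s < v) : ∃ Y : C(ℝ, ℝ), IsUnfoldedSolution r g v Y := by
  have key : ∀ ε : ℝ, 0 < ε → ∃ U : ℝ → ℝ, Continuous U ∧
      ∀ t ∈ Icc 0 T, U t = unfoldedPosition r g v U (t - ε) := by
    intro ε hε
    -- Iterates of the delayed map. The force vanishes at negative times, so the value at `t`
    -- depends only on the previous iterate on `(0, t - ε]`; hence each step extends the region of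
    -- stability by `ε`, and finitely many steps cover `[0, T]`.
    let W : ℕ → ℝ → ℝ := fun k => Nat.rec (fun _ => 0)
      (fun _ u t => unfoldedPosition r g v u (t - ε)) k
    have hW : ∀ k t, W (k + 1) t = unfoldedPosition r g v (W k) (t - ε) := fun k t => rfl
    have hWc : ∀ k, Continuous (W k) := by
      intro k
      induction k with
      | zero => exact continuous_const
      | succ k ih =>
        exact (hg.continuous_unfoldedPosition ih).comp (continuous_id.sub continuous_const)
    have hcongr : ∀ u₁ u₂ : ℝ → ℝ, ∀ t, (∀ s ∈ Ioc 0 t, u₁ s = u₂ s) →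
        unfoldedPosition r g v u₁ t = unfoldedPosition r g v u₂ t := by
      intro u₁ u₂ t h
      refine intervalIntegral.integral_congr fun s hs => ?_
      refine congrArg (v + ·) (intervalIntegral.integral_congr_ae ?_)
      filter_upwards [compl_mem_ae_iff.2 (measure_singleton (0 : ℝ))] with τ hτ0 hτ
      by_cases h0 : τ ∈ Icc 0 T
      · have hpos : 0 < τ := lt_of_le_of_ne h0.1 (Ne.symm hτ0)
        have h1 : τ ≤ s := (le_max_iff.1 hτ.2).resolve_left hpos.not_ge
        have h2 : s ≤ t := (le_max_iff.1 hs.2).resolve_left (hpos.trans_le h1).not_ge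
        rw [h τ ⟨hpos, h1.trans h2⟩]
      · rw [hg.unfoldedForce_eq_zero h0, hg.unfoldedForce_eq_zero h0]
    have hstab : ∀ k : ℕ, ∀ t ∈ Ioc 0 (k * ε), W (k + 1) t = W k t := by
      intro k
      induction k with
      | zero => intro t ht; simp at ht
      | succ k ih =>
        intro t ht
        rw [hW (k + 1), hW k]
        refine hcongr _ _ _ fun s hs => ih s ⟨hs.1, hs.2.trans ?_⟩
        have := ht.2
        push_cast at this
        linarith
    obtain ⟨k, hk⟩ := exists_nat_ge (T / ε)
    have hk : T ≤ k * ε := (div_le_iff₀ hε).1 hk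
    refine ⟨W (k + 1), hWc (k + 1), fun t ht => ?_⟩
    rw [hW k]
    refine hcongr _ _ _ fun s hs => (hstab k s ⟨hs.1, hs.2.trans ?_⟩).symm
    linarith [ht.2]
  choose U hUc hU using fun n : ℕ => key (1 / ((n : ℝ) + 1)) (by positivity)
  have hclose : ∀ t ∈ Icc 0 T,
      Tendsto (fun n => U n t - unfoldedPosition r g v (U n) t) atTop (𝓝 0) := by
    intro t ht
    have hC : |v| + ∫ s, M s ≤ (|v| + ∫ s, M s).toNNReal := Real.le_coe_toNNReal _
    refine squeeze_zero_norm
      (a := fun n : ℕ => ((|v| + ∫ s, M s).toNNReal : ℝ) * (1 / ((n : ℝ) + 1))) (fun n => ?_) ?_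
    · have h := (hg.lipschitzWith_unfoldedPosition (r := r) (hUc n) hC).dist_le_mul
        (t - 1 / ((n : ℝ) + 1)) t
      rw [Real.dist_eq, Real.dist_eq, sub_sub_cancel_left, abs_neg,
        abs_of_pos (by positivity : 0 < 1 / ((n : ℝ) + 1))] at h
      rw [hU n t ht]
      exact h
    · simpa using tendsto_one_div_add_atTop_nhds_zero_nat.const_mul
        ((|v| + ∫ s, M s).toNNReal : ℝ)
  obtain ⟨Z, -, -, -, hZ⟩ := hg.exists_subseq_tendsto hr (tendsto_const_nhds (x := v)) hv hUc
    (Y := fun n => ⟨unfoldedPosition r g v (U n), hg.continuous_unfoldedPosition (hUc n)⟩)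
    (fun n t => rfl) hclose
  exact ⟨Z, hZ⟩

end IsRegularForce

/-! ### Folding an unfolded solution gives a billiard solution -/

namespace IsUnfoldedSolution

variable {r T v : ℝ} {g : ℝ → ℝ → ℝ} {M A : ℝ → ℝ} {Y : C(ℝ, ℝ)}

lemma map_zero (hY : IsUnfoldedSolution r g v Y) : Y 0 = 0 := by
  rw [hY, IsRegularForce.unfoldedPosition_zero]

lemma hasDerivAt (hY : IsUnfoldedSolution r g v Y) (hg : IsRegularForce T g M A) (t : ℝ) :
    HasDerivAt Y (unfoldedVelocity r g v Y t) t := by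
  have := hg.hasDerivAt_unfoldedPosition (r := r) (v := v) Y.continuous t
  rwa [← funext hY] at this

lemma velocity_pos (hg : IsRegularForce T g M A) (hv : ∫ s, M s < v) (t : ℝ) :
    0 < unfoldedVelocity r g v Y t := by
  linarith [(abs_le.1 (hg.abs_unfoldedVelocity_sub_le (r := r) (v := v) (u := Y) t)).1]

lemma mul_sub_le (hY : IsUnfoldedSolution r g v Y) (hg : IsRegularForce T g M A) {s t : ℝ}
    (hst : s ≤ t) : (v - ∫ s, M s) * (t - s) ≤ Y t - Y s := by
  rw [hY t, hY s]
  exact hg.mul_sub_le_unfoldedPosition_sub Y.continuous hst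

lemma strictMono (hY : IsUnfoldedSolution r g v Y) (hg : IsRegularForce T g M A)
    (hv : ∫ s, M s < v) : StrictMono Y := fun s t hst => by
  have := hY.mul_sub_le hg hst.le
  nlinarith

lemma hasDerivAt_fold_comp (hY : IsUnfoldedSolution r g v Y) (hg : IsRegularForce T g M A)
    (hr : 0 < r) {t : ℝ} (ht : |fold r (Y t)| < r) :
    HasDerivAt (fun t => fold r (Y t)) (foldSign r (Y t) * unfoldedVelocity r g v Y t) t :=
  (hasDerivAt_fold hr ht).comp t (hY.hasDerivAt hg t)

/-- At an impact the velocity of the folded trajectory is reversed. -/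
lemma exists_hasDerivWithinAt_impact (hY : IsUnfoldedSolution r g v Y)
    (hg : IsRegularForce T g M A) (hr : 0 < r) (hv : ∫ s, M s < v) {t : ℝ}
    (ht : |fold r (Y t)| = r) :
    ∃ p : ℝ, p ≠ 0 ∧ HasDerivWithinAt (fun t => fold r (Y t)) p (Iic t) t ∧
      HasDerivWithinAt (fun t => fold r (Y t)) (-p) (Ici t) t := by
  obtain ⟨n, hn⟩ := (abs_fold_eq_iff hr _).1 ht
  -- Monotonicity of `Y` sends the left and right of `t` to the left and right of `Y t`, so the
  -- one-sided chain rule applies; the slopes of the fold on the two sides are opposite.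
  have hmono := (hY.strictMono hg hv).monotone
  have hw := velocity_pos (r := r) (Y := Y) hg hv t
  have hn' : Y t = 2 * r * ((n - 1 : ℤ) : ℝ) + r := by rw [hn]; push_cast; ring
  refine ⟨(-1) ^ (n - 1) * unfoldedVelocity r g v Y t, ?_, ?_, ?_⟩
  · exact mul_ne_zero (zpow_ne_zero _ (by norm_num)) hw.ne'
  · have h := hasDerivWithinAt_fold_Iic hr (n - 1)
    rw [← hn'] at h
    exact h.comp t (hY.hasDerivAt hg t).hasDerivWithinAt fun s hs => hmono hs
  · have h := hasDerivWithinAt_fold_Ici hr n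
    rw [← hn] at h
    have := h.comp t (hY.hasDerivAt hg t).hasDerivWithinAt fun s (hs : s ∈ Ici t) => hmono hs
    convert! this using 1
    rw [zpow_sub_one₀ (by norm_num)]
    norm_num

/-- To leave its linear piece of the fold, the increasing path would have to cross an odd multiple
of `r`, which is an impact. -/
lemma foldSign_eq_of_forall_lt (hY : IsUnfoldedSolution r g v Y)
    (hg : IsRegularForce T g M A) (hr : 0 < r) (hv : ∫ s, M s < v) {c d : ℝ}
    (h : ∀ t ∈ Icc c d, |fold r (Y t)| < r) : ∀ t ∈ Icc c d, foldSign r (Y t) = foldSign r (Y c) := by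
  intro t ht
  obtain ⟨n, hn⟩ := exists_abs_sub_le hr (Y c)
  have hc := h c ⟨le_rfl, ht.1.trans ht.2⟩
  rw [abs_fold hr hn] at hc
  have hmono := (hY.strictMono hg hv).monotone
  have hlt : Y t < 2 * r * n + r := by
    by_contra! hcon
    obtain ⟨s, hs, hs'⟩ := intermediate_value_Icc ht.1 Y.continuous.continuousOn
      ⟨by linarith [(abs_lt.1 hc).2], hcon⟩
    refine (h s ⟨hs.1, hs.2.trans ht.2⟩).ne ((abs_fold_eq_iff hr _).2 ⟨n + 1, ?_⟩)
    rw [hs']; push_cast; ring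
  have hge := hmono ht.1
  rw [foldSign_eq hr hc, foldSign_eq hr (n := n)]
  rw [abs_lt] at hc ⊢
  constructor <;> linarith

lemma isBilliardSolution (hY : IsUnfoldedSolution r g v Y) (hg : IsRegularForce T g M A)
    (hr : 0 < r) (hv : ∫ s, M s < v) {f : ℝ → ℝ → ℝ}
    (hfg : ∀ᵐ t : ℝ, t ∈ Icc 0 T → ∀ x, f t x = g t x) :
    IsBilliardSolution r T f v fun t => fold r (Y t) where
  continuousOn := ((continuous_fold r).comp Y.continuous).continuousOn
  mem_table t _ := abs_le.1 (abs_fold_le hr _)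
  motion c d hc hcd hd hin := by
    have hin' : ∀ t ∈ Icc c d, |fold r (Y t)| < r := fun t ht => abs_lt.2 (hin t ht)
    have hsign := hY.foldSign_eq_of_forall_lt hg hr hv hin'
    have hint := hg.integrable_unfoldedForce (r := r) Y.continuous
    refine ⟨fun t => foldSign r (Y c) * unfoldedVelocity r g v Y t, ?_, fun t ht => ?_, ?_⟩
    · have hac := (hint.intervalIntegrable (a := min 0 c) (b := max 0 d)
        ).absolutelyContinuousOnInterval_intervalIntegral (c := 0) (by
          rw [uIcc_of_le ((min_le_left _ _).trans (le_max_left _ _))]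
          exact ⟨min_le_left _ _, le_max_left _ _⟩)
      have hac' := hac.mono (c := c) (d := d) (by
        rw [uIcc_of_le hcd.le, uIcc_of_le ((min_le_left _ _).trans (le_max_left _ _))]
        exact Icc_subset_Icc (min_le_right _ _) (le_max_right _ _))
      have hconst : AbsolutelyContinuousOnInterval (fun _ : ℝ => v) c d :=
        ((LipschitzWith.const v).lipschitzOnWith (s := uIcc c d)).absolutelyContinuousOnInterval
      exact (hconst.add hac').const_mul _
    · rw [← hsign t ht]
      exact (hY.hasDerivAt_fold_comp hg hr (hin' t ht)).hasDerivWithinAt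
    · filter_upwards [LocallyIntegrable.ae_hasDerivAt_integral hint.locallyIntegrable, hfg] with t h1 h2 ht
      have h3 := ((h1 0).const_add v).const_mul (foldSign r (Y c))
      have ht' := Ioo_subset_Icc_self ht
      rw [h2 ⟨hc.trans ht'.1, ht'.2.trans hd⟩]
      refine h3.congr_deriv ?_
      rw [unfoldedForce, hsign t ht', ← mul_assoc, foldSign_mul_self, one_mul]
  impact s _ h := by
    obtain ⟨p, -, h1, h2⟩ := hY.exists_hasDerivWithinAt_impact hg hr hv (t := s) ((abs_eq hr.le).2 h)
    refine ⟨p, h1, ?_⟩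
    rwa [impulse, show p + -2 * p = -p by ring]
  initial_position := by rw [hY.map_zero, fold_zero]
  initial_velocity := by
    have h := hY.hasDerivAt_fold_comp hg hr (t := 0) (by simp [hY.map_zero, fold_zero, hr])
    rw [hY.map_zero, foldSign_eq hr (n := 0) (by simpa using hr)] at h
    simpa [unfoldedVelocity] using h.hasDerivWithinAt

end IsUnfoldedSolution

/-! ### Uniqueness of billiard solutions -/

/-- One-sided derivatives from the left of functions that agree to the left. -/
lemma HasDerivWithinAt.eq_of_eqOn_Icc {x z : ℝ → ℝ} {p q c τ : ℝ}
    (hx : HasDerivWithinAt x p (Iic τ) τ) (hz : HasDerivWithinAt z q (Iic τ) τ) (hc : c < τ)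
    (h : EqOn z x (Icc c τ)) : p = q := by
  have hcongr : HasDerivWithinAt z p (Iic τ) τ := by
    refine hx.congr_of_eventuallyEq ?_ (h ⟨hc.le, le_rfl⟩)
    filter_upwards [self_mem_nhdsWithin, mem_nhdsWithin_of_mem_nhds (Ioi_mem_nhds hc)]
      with t ht ht' using h ⟨le_of_lt ht', ht⟩
  exact (uniqueDiffWithinAt_Iic τ).eq_deriv _ hcongr hz

namespace IsRegularForce

variable {T : ℝ} {g : ℝ → ℝ → ℝ} {M A : ℝ → ℝ}

lemma lipschitz_nonneg (hg : IsRegularForce T g M A) (t : ℝ) : 0 ≤ A t := by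
  have := (abs_nonneg _).trans (hg.lipschitz t 1 0)
  simpa using this

/-- Local uniqueness for the second order equation without impacts. -/
lemma exists_eqOn_Icc (hg : IsRegularForce T g M A) {u₁ u₂ : ℝ → ℝ} (h₁ : Continuous u₁)
    (h₂ : Continuous u₂) {τ d x₀ q : ℝ} (hτd : τ < d)
    (hu₁ : ∀ t ∈ Icc τ d, u₁ t = x₀ + ∫ s in τ..t, (q + ∫ σ in τ..s, g σ (u₁ σ)))
    (hu₂ : ∀ t ∈ Icc τ d, u₂ t = x₀ + ∫ s in τ..t, (q + ∫ σ in τ..s, g σ (u₂ σ))) :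
    ∃ e ∈ Ioc τ d, EqOn u₁ u₂ (Icc τ e) := by
  have hAint : ∀ a b, IntervalIntegrable A volume a b := fun _ _ =>
    hg.integrable_lipschitz.intervalIntegrable
  have hgint : ∀ u : ℝ → ℝ, Continuous u → ∀ a b,
      IntervalIntegrable (fun σ => g σ (u σ)) volume a b := fun u hu _ _ =>
    (hg.integrable_comp hu).intervalIntegrable
  have hprim : ∀ u : ℝ → ℝ, Continuous u → Continuous fun s => q + ∫ σ in τ..s, g σ (u σ) :=
    fun u hu => continuous_const.add (intervalIntegral.continuous_primitive (hgint u hu) τ)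
  have hsmall : ∀ᶠ e in 𝓝[>] τ, (d - τ) * ∫ σ in τ..e, A σ < 1 / 2 := by
    refine nhdsWithin_le_nhds ?_
    have hc : Continuous fun e => (d - τ) * ∫ σ in τ..e, A σ :=
      continuous_const.mul (intervalIntegral.continuous_primitive hAint τ)
    exact hc.continuousAt.eventually_lt continuousAt_const (by simp)
  obtain ⟨e, he, hed⟩ := (hsmall.and (Ioc_mem_nhdsGT hτd)).exists
  refine ⟨e, hed, ?_⟩
  obtain ⟨t₀, ht₀, hmax⟩ := isCompact_Icc.exists_isMaxOn (nonempty_Icc.2 hed.1.le)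
    (h₁.sub h₂).abs.continuousOn
  set D := |(u₁ - u₂) t₀| with hD
  have hle : ∀ t ∈ Icc τ e, |u₁ t - u₂ t| ≤ D := fun t ht => hmax ht
  have hinner : ∀ s ∈ Icc τ e,
      |(q + ∫ σ in τ..s, g σ (u₁ σ)) - (q + ∫ σ in τ..s, g σ (u₂ σ))| ≤ D * ∫ σ in τ..e, A σ := by
    intro s hs
    rw [add_sub_add_left_eq_sub, ← intervalIntegral.integral_sub (hgint _ h₁ _ _) (hgint _ h₂ _ _),
      ← Real.norm_eq_abs, ← intervalIntegral.integral_const_mul]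
    calc _ ≤ ∫ σ in τ..s, D * A σ := by
          refine intervalIntegral.norm_integral_le_of_norm_le hs.1
            (Eventually.of_forall fun σ hσ => ?_) ((hAint _ _).const_mul _)
          refine (hg.lipschitz σ _ _).trans ?_
          rw [mul_comm]
          exact mul_le_mul_of_nonneg_right (hle σ ⟨hσ.1.le, hσ.2.trans hs.2⟩)
            (hg.lipschitz_nonneg σ)
      _ ≤ _ := by
          refine intervalIntegral.integral_mono_interval le_rfl hs.1 hs.2
            (Eventually.of_forall fun σ => ?_) ((hAint _ _).const_mul _)
          exact mul_nonneg (abs_nonneg _) (hg.lipschitz_nonneg σ)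
  have hDle : D ≤ D * (∫ σ in τ..e, A σ) * (d - τ) := by
    have hd := Icc_subset_Icc_right hed.2 ht₀
    have hdiff : D = ‖∫ s in τ..t₀, ((q + ∫ σ in τ..s, g σ (u₁ σ)) -
        (q + ∫ σ in τ..s, g σ (u₂ σ)))‖ := by
      rw [hD, Pi.sub_apply, hu₁ t₀ hd, hu₂ t₀ hd, add_sub_add_left_eq_sub,
        ← intervalIntegral.integral_sub ((hprim _ h₁).intervalIntegrable _ _)
          ((hprim _ h₂).intervalIntegrable _ _), Real.norm_eq_abs]
    refine hdiff.le.trans ((intervalIntegral.norm_integral_le_of_norm_le_const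
      (C := D * ∫ σ in τ..e, A σ) fun s hs => ?_).trans ?_)
    · rw [uIoc_of_le ht₀.1] at hs
      exact hinner s ⟨hs.1.le, hs.2.trans ht₀.2⟩
    · rw [abs_of_nonneg (sub_nonneg.2 ht₀.1)]
      refine mul_le_mul_of_nonneg_left (by linarith [hd.2]) (mul_nonneg (abs_nonneg _) ?_)
      exact intervalIntegral.integral_nonneg hed.1.le fun σ _ => hg.lipschitz_nonneg σ
  -- The choice of `e` makes the factor of `D` in `hDle` less than `1 / 2`.
  have hD0 : D ≤ 0 := by nlinarith [abs_nonneg ((u₁ - u₂) t₀)]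
  intro t ht
  exact sub_eq_zero.1 (abs_nonpos_iff.1 ((hle t ht).trans hD0))

end IsRegularForce

namespace IsBilliardSolution

variable {r T v : ℝ} {f g : ℝ → ℝ → ℝ} {M A z : ℝ → ℝ}

lemma exists_continuous_eqOn (hz : IsBilliardSolution r T f v z) (hT : 0 ≤ T) :
    ∃ u : ℝ → ℝ, Continuous u ∧ EqOn u z (Icc 0 T) :=
  ⟨fun t => z (projIcc 0 T hT t),
    hz.continuousOn.comp_continuous (continuous_subtype_val.comp continuous_projIcc)
      fun t => (projIcc 0 T hT t).2,
    fun t ht => by simp only [projIcc_of_mem hT ht]⟩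

/-- A motion that starts at time `τ`, possibly on the boundary, and stays in the interior of the
table up to time `d` solves the integral equation. -/
lemma eq_integral (hz : IsBilliardSolution r T f v z) (hg : IsRegularForce T g M A)
    (hfg : ∀ᵐ t : ℝ, t ∈ Icc 0 T → ∀ x, f t x = g t x) {u : ℝ → ℝ} (hu : Continuous u)
    (huz : EqOn u z (Icc 0 T)) {τ d q : ℝ} (hτ : 0 ≤ τ) (hτd : τ < d) (hd : d ≤ T)
    (hin : ∀ t ∈ Ioc τ d, z t ∈ Ioo (-r) r) (hq : HasDerivWithinAt z q (Ici τ) τ) :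
    ∀ t ∈ Icc τ d, z t = z τ + ∫ s in τ..t, (q + ∫ σ in τ..s, g σ (u σ)) := by
  have hgint : ∀ a b, IntervalIntegrable (fun σ => g σ (u σ)) volume a b := fun _ _ =>
    (hg.integrable_comp hu).intervalIntegrable
  have hGc : Continuous fun s => ∫ σ in τ..s, g σ (u σ) :=
    intervalIntegral.continuous_primitive hgint τ
  have hzc : ContinuousOn z (Icc τ d) := hz.continuousOn.mono (Icc_subset_Icc hτ hd)
  have hstep : ∀ s t, τ < s → s ≤ t → t < d → DifferentiableAt ℝ z s ∧ DifferentiableAt ℝ z t ∧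
      deriv z t - deriv z s = ∫ σ in s..t, g σ (u σ) := by
    intro s t hs hst ht
    -- The equation of motion is available only on closed intervals in the interior, so `τ`,
    -- possibly an impact, is avoided.
    obtain ⟨c, hc, hcs⟩ := exists_between hs
    obtain ⟨w, hw, hzw, hwf⟩ := hz.motion c d (hτ.trans hc.le) (by linarith) hd
      fun x hx => hin x ⟨hc.trans_le hx.1, hx.2⟩
    have hderiv : ∀ x ∈ Ioo c d, HasDerivAt z (w x) x := fun x hx =>
      (hzw x (Ioo_subset_Icc_self hx)).hasDerivAt (Icc_mem_nhds hx.1 hx.2)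
    have h1 := hderiv s ⟨hcs, hst.trans_lt ht⟩
    have h2 := hderiv t ⟨hcs.trans_le hst, ht⟩
    refine ⟨h1.differentiableAt, h2.differentiableAt, ?_⟩
    rw [h1.deriv, h2.deriv]
    have hw' : AbsolutelyContinuousOnInterval w s t := hw.mono (by
      rw [uIcc_of_le hst, uIcc_of_le (by linarith)]
      exact Icc_subset_Icc hcs.le ht.le)
    rw [← hw'.integral_deriv_eq_sub]
    refine intervalIntegral.integral_congr_ae ?_
    filter_upwards [hwf, hfg] with x h3 h4 hx
    rw [uIoc_of_le hst] at hx
    have hxT : x ∈ Icc 0 T := ⟨by linarith [hx.1], by linarith [hx.2]⟩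
    rw [(h3 ⟨hcs.trans hx.1, hx.2.trans_lt ht⟩).deriv, h4 hxT, huz hxT]
  obtain ⟨e, hτe, hed⟩ := exists_between hτd
  -- The constant that makes the velocity formula exact at the reference time `e`. The velocity
  -- tends to `κ` as `t` decreases to `τ`, so `κ` is the right derivative at `τ`, that is `q`.
  set κ := deriv z e - ∫ σ in τ..e, g σ (u σ) with hκ
  have hderiv : ∀ t ∈ Ioo τ d, HasDerivAt z (κ + ∫ σ in τ..t, g σ (u σ)) t := by
    intro t ht
    rcases le_total t e with h | h
    · obtain ⟨h1, -, h2⟩ := hstep t e ht.1 h hed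
      convert! h1.hasDerivAt using 1
      have := intervalIntegral.integral_add_adjacent_intervals (hgint τ t) (hgint t e)
      linarith
    · obtain ⟨-, h1, h2⟩ := hstep e t hτe h ht.2
      convert! h1.hasDerivAt using 1
      have := intervalIntegral.integral_add_adjacent_intervals (hgint τ e) (hgint e t)
      linarith
  have hκ' : HasDerivWithinAt z κ (Ici τ) τ := by
    refine hasDerivWithinAt_Ici_of_tendsto_deriv (s := Ioo τ d)
      (fun t ht => (hderiv t ht).differentiableAt.differentiableWithinAt)
      ((hzc τ ⟨le_rfl, hτd.le⟩).mono Ioo_subset_Icc_self) (Ioo_mem_nhdsGT hτd) ?_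
    have hlim : Tendsto (fun t => κ + ∫ σ in τ..t, g σ (u σ)) (𝓝[>] τ) (𝓝 κ) := by
      have := (continuous_const.add hGc).tendsto (f := fun t => κ + ∫ σ in τ..t, g σ (u σ)) τ
      rw [intervalIntegral.integral_same, add_zero] at this
      exact this.mono_left nhdsWithin_le_nhds
    refine hlim.congr' ?_
    filter_upwards [Ioo_mem_nhdsGT hτd] with t ht using (hderiv t ht).deriv.symm
  have hκq : κ = q := (uniqueDiffWithinAt_Ici τ).eq_deriv _ hκ' hq
  rw [hκq] at hderiv
  intro t ht
  have hftc := intervalIntegral.integral_eq_sub_of_hasDeriv_right_of_le ht.1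
    (hzc.mono (Icc_subset_Icc_right ht.2))
    (fun s hs => (hderiv s ⟨hs.1, hs.2.trans_le ht.2⟩).hasDerivWithinAt)
    ((continuous_const.add hGc).intervalIntegrable _ _)
  rw [hftc]
  ring

/-- A solution with nonzero velocity to the right is in the interior immediately afterwards. -/
lemma eventually_mem_Ioo (hz : IsBilliardSolution r T f v z) {τ q : ℝ} (hτ : τ ∈ Ico 0 T)
    (hq : HasDerivWithinAt z q (Ici τ) τ) (hq0 : q ≠ 0) :
    ∀ᶠ t in 𝓝[>] τ, z t ∈ Ioo (-r) r := by
  have hne : ∀ c : ℝ, ∀ᶠ t in 𝓝[>] τ, z t ≠ c := by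
    intro c
    have hq' : HasDerivWithinAt z q (Ioi τ) τ := hq.mono Ioi_subset_Ici_self
    by_cases hc : z τ = c
    · have := hq'.eventually_ne (c := c) hq0
      simpa using this
    · exact hq'.continuousWithinAt.eventually_ne hc
  filter_upwards [hne r, hne (-r), Ioo_mem_nhdsGT hτ.2] with t h1 h2 ht
  have := hz.mem_table t ⟨hτ.1.trans ht.1.le, ht.2.le⟩
  exact ⟨lt_of_le_of_ne this.1 h2.symm, lt_of_le_of_ne this.2 h1⟩

end IsBilliardSolution

namespace IsUnfoldedSolution

variable {r T v : ℝ} {f g : ℝ → ℝ → ℝ} {M A z : ℝ → ℝ} {Y : C(ℝ, ℝ)}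

/-- The common past determines the outgoing velocity: by the initial condition at time `0`, by
reversal of the shared left derivative at an impact, and by differentiability at an interior point.
-/
lemma exists_hasDerivWithinAt_Ici (hY : IsUnfoldedSolution r g v Y) (hg : IsRegularForce T g M A)
    (hr : 0 < r) (hv : ∫ s, M s < v) (hfg : ∀ᵐ t : ℝ, t ∈ Icc 0 T → ∀ x, f t x = g t x)
    (hz : IsBilliardSolution r T f v z) {τ : ℝ} (hτ : τ ∈ Ico 0 T)
    (h : EqOn z (fun t => fold r (Y t)) (Icc 0 τ)) :
    ∃ q ≠ 0, HasDerivWithinAt z q (Ici τ) τ ∧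
      HasDerivWithinAt (fun t => fold r (Y t)) q (Ici τ) τ := by
  have hx := hY.isBilliardSolution hg hr hv hfg
  rcases hτ.1.eq_or_lt with rfl | hτ0
  · refine ⟨v, ?_, hz.initial_velocity, hx.initial_velocity⟩
    exact ((integral_nonneg hg.bound_nonneg).trans_lt hv).ne'
  have hzτ : z τ = fold r (Y τ) := h ⟨hτ.1, le_rfl⟩
  rcases (abs_fold_le hr (Y τ)).eq_or_lt with himp | hint
  · obtain ⟨p, hp0, hp1, hp2⟩ := hY.exists_hasDerivWithinAt_impact hg hr hv himp
    obtain ⟨p', hp1', hp2'⟩ := hz.impact τ ⟨hτ0, hτ.2⟩ (by rw [hzτ]; exact (abs_eq hr.le).1 himp)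
    obtain rfl := hp1.eq_of_eqOn_Icc hp1' hτ0 h
    refine ⟨-p, neg_ne_zero.2 hp0, ?_, hp2⟩
    rwa [impulse, show p + -2 * p = -p by ring] at hp2'
  · have hcont : ContinuousAt z τ := hz.continuousOn.continuousAt (Icc_mem_nhds hτ0 hτ.2)
    have hnhds : ∀ᶠ t in 𝓝 τ, z t ∈ Ioo (-r) r ∧ t ∈ Ioo 0 T :=
      (hcont.eventually_mem (Ioo_mem_nhds (by rw [hzτ]; exact (abs_lt.1 hint).1)
        (by rw [hzτ]; exact (abs_lt.1 hint).2))).and (Ioo_mem_nhds hτ0 hτ.2)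
    obtain ⟨ε, hε, hball⟩ := Metric.nhds_basis_closedBall.mem_iff.1 hnhds
    rw [Real.closedBall_eq_Icc] at hball
    obtain ⟨w, -, hzw, -⟩ := hz.motion (τ - ε) (τ + ε)
      (hball ⟨le_rfl, by linarith⟩).2.1.le (by linarith) (hball ⟨by linarith, le_rfl⟩).2.2.le
      fun t ht => (hball ht).1
    have hz' := (hzw τ ⟨by linarith, by linarith⟩).hasDerivAt
      (Icc_mem_nhds (by linarith) (by linarith))
    have hx' := hY.hasDerivAt_fold_comp hg hr hint
    have heq := hx'.hasDerivWithinAt.eq_of_eqOn_Icc hz'.hasDerivWithinAt hτ0 h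
    refine ⟨w τ, ?_, hz'.hasDerivWithinAt, ?_⟩
    · rw [← heq]
      refine mul_ne_zero (fun h0 => ?_) (velocity_pos hg hv τ).ne'
      simpa [h0] using foldSign_mul_self r (Y τ)
    · rw [← heq]; exact hx'.hasDerivWithinAt

lemma exists_gt_eqOn (hY : IsUnfoldedSolution r g v Y) (hg : IsRegularForce T g M A)
    (hr : 0 < r) (hv : ∫ s, M s < v) (hfg : ∀ᵐ t : ℝ, t ∈ Icc 0 T → ∀ x, f t x = g t x)
    (hz : IsBilliardSolution r T f v z) {τ : ℝ} (hτ : τ ∈ Ico 0 T)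
    (h : EqOn z (fun t => fold r (Y t)) (Icc 0 τ)) :
    ∃ e > τ, EqOn z (fun t => fold r (Y t)) (Icc τ e) := by
  have hx := hY.isBilliardSolution hg hr hv hfg
  have hT : 0 ≤ T := hτ.1.trans hτ.2.le
  obtain ⟨q, hq0, hzq, hxq⟩ := hY.exists_hasDerivWithinAt_Ici hg hr hv hfg hz hτ h
  obtain ⟨d, hτd, hd⟩ := (mem_nhdsGT_iff_exists_Ioc_subset).1
    (((hz.eventually_mem_Ioo hτ hzq hq0).and (hx.eventually_mem_Ioo hτ hxq hq0)).and
      (Ioo_mem_nhdsGT hτ.2))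
  have hdT : d ≤ T := (hd ⟨hτd, le_rfl⟩).2.2.le
  obtain ⟨u, hu, huz⟩ := hz.exists_continuous_eqOn hT
  have hxc : Continuous fun t => fold r (Y t) := (continuous_fold r).comp Y.continuous
  have h1 := hz.eq_integral hg hfg hu huz hτ.1 hτd hdT (fun t ht => (hd ht).1.1) hzq
  have h2 := hx.eq_integral hg hfg hxc (fun _ _ => rfl) hτ.1 hτd hdT (fun t ht => (hd ht).1.2) hxq
  have hsub : Icc τ d ⊆ Icc 0 T := Icc_subset_Icc hτ.1 hdT
  obtain ⟨e, he, heq⟩ := hg.exists_eqOn_Icc (x₀ := z τ) (q := q) hu hxc hτd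
    (fun t ht => by rw [huz (hsub ht), h1 t ht])
    (fun t ht => by rw [h ⟨hτ.1, le_rfl⟩, h2 t ht])
  refine ⟨e, he.1, fun t ht => ?_⟩
  rw [← huz (hsub (Icc_subset_Icc_right he.2 ht)), heq ht]

/-- Uniqueness of the billiard solution. -/
lemma eqOn_fold_comp (hY : IsUnfoldedSolution r g v Y) (hg : IsRegularForce T g M A)
    (hr : 0 < r) (hv : ∫ s, M s < v) (hfg : ∀ᵐ t : ℝ, t ∈ Icc 0 T → ∀ x, f t x = g t x)
    (hz : IsBilliardSolution r T f v z) : EqOn z (fun t => fold r (Y t)) (Icc 0 T) := by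
  have hxc : Continuous fun t => fold r (Y t) := (continuous_fold r).comp Y.continuous
  by_contra hne
  obtain ⟨t₁, ht₁, hne₁⟩ : ∃ t ∈ Icc 0 T, z t ≠ fold r (Y t) := by
    simpa [EqOn, and_assoc] using hne
  let S := {t | t ∈ Icc 0 T ∧ z t ≠ fold r (Y t)}
  have hSb : BddBelow S := ⟨0, fun t ht => ht.1.1⟩
  have hSne : S.Nonempty := ⟨t₁, ht₁, hne₁⟩
  -- The infimum of the times of disagreement; agreement extends to `τ` by continuity and then
  -- beyond it by `exists_gt_eqOn`, a contradiction.
  set τ := sInf S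
  have hτ0 : 0 ≤ τ := le_csInf hSne fun t ht => ht.1.1
  have hτt : τ ≤ t₁ := csInf_le hSb ⟨ht₁, hne₁⟩
  have hτT : τ ≤ T := hτt.trans ht₁.2
  have hlt : ∀ t, 0 ≤ t → t < τ → z t = fold r (Y t) := fun t h0 ht => by
    by_contra hcon
    exact (csInf_le hSb ⟨⟨h0, ht.le.trans hτT⟩, hcon⟩).not_gt ht
  have hτeq : z τ = fold r (Y τ) := by
    rcases hτ0.eq_or_lt with h0 | h0
    · rw [← h0, hz.initial_position, hY.map_zero, fold_zero]
    · have hlim1 : Tendsto z (𝓝[Ico 0 τ] τ) (𝓝 (z τ)) :=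
        (hz.continuousOn τ ⟨hτ0, hτT⟩).mono fun t ht => ⟨ht.1, ht.2.le.trans hτT⟩
      have hlim2 : Tendsto (fun t => fold r (Y t)) (𝓝[Ico 0 τ] τ) (𝓝 (fold r (Y τ))) :=
        hxc.continuousWithinAt
      have hbot : (𝓝[Ico 0 τ] τ).NeBot := by
        rw [← mem_closure_iff_nhdsWithin_neBot, closure_Ico h0.ne]
        exact ⟨hτ0, le_rfl⟩
      refine tendsto_nhds_unique hlim1 (hlim2.congr' ?_)
      filter_upwards [self_mem_nhdsWithin] with t ht using (hlt t ht.1 ht.2).symm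
  have heq : EqOn z (fun t => fold r (Y t)) (Icc 0 τ) := fun t ht => by
    rcases ht.2.eq_or_lt with h | h
    · rw [h]; exact hτeq
    · exact hlt t ht.1 h
  have hτlt : τ < T := by
    refine lt_of_le_of_ne hτT fun h => ?_
    exact hne₁ (heq ⟨ht₁.1, h ▸ ht₁.2⟩)
  obtain ⟨e, he, heqe⟩ := hY.exists_gt_eqOn hg hr hv hfg hz ⟨hτ0, hτlt⟩ heq
  obtain ⟨t, ht, hte⟩ := exists_lt_of_csInf_lt hSne he
  exact ht.2 (heqe ⟨csInf_le hSb ht, hte.le⟩)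

end IsUnfoldedSolution

/-! ### Uniqueness and continuous dependence upstairs -/

namespace IsUnfoldedSolution

variable {r T v b : ℝ} {g : ℝ → ℝ → ℝ} {M A : ℝ → ℝ} {Y Z : C(ℝ, ℝ)}

/-- Folded paths coincide by billiard uniqueness, so the speeds agree at almost every time of `[0,
T]`. Both unfolded velocities are positive, hence equal there, and integration gives equal
positions. Off `[0, T]` the force vanishes. -/
lemma eq (hY : IsUnfoldedSolution r g v Y) (hZ : IsUnfoldedSolution r g v Z)
    (hg : IsRegularForce T g M A) (hr : 0 < r) (hv : ∫ s, M s < v) : Y = Z := by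
  have hgg : ∀ᵐ t : ℝ, t ∈ Icc 0 T → ∀ x, g t x = g t x :=
    Eventually.of_forall fun _ _ _ => rfl
  have hfold := hY.eqOn_fold_comp hg hr hv hgg (hZ.isBilliardSolution hg hr hv hgg)
  have hIcc : EqOn Y Z (Icc 0 T) := by
    intro t ht
    rw [hY, hZ]
    refine intervalIntegral.integral_congr_ae ?_
    filter_upwards [ae_abs_fold_comp_lt hr (hY.strictMono hg hv).injective,
      compl_mem_ae_iff.2 (measure_singleton t)] with s hs hst hs'
    rw [uIoc_of_le ht.1] at hs'
    have hsT : s ∈ Ioo 0 T := ⟨hs'.1, (lt_of_le_of_ne hs'.2 hst).trans_le ht.2⟩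
    have hYd := hY.hasDerivAt_fold_comp hg hr hs
    have hZd := hZ.hasDerivAt_fold_comp hg hr (t := s) (by
      rwa [show fold r (Z s) = fold r (Y s) from hfold (Ioo_subset_Icc_self hsT)])
    have heq := hYd.unique (hZd.congr_of_eventuallyEq (by
      filter_upwards [Icc_mem_nhds hsT.1 hsT.2] with τ hτ using (hfold hτ).symm))
    have habs := congrArg abs heq
    rwa [abs_mul, abs_mul, abs_foldSign, abs_foldSign, one_mul, one_mul,
      abs_of_pos (velocity_pos hg hv s), abs_of_pos (velocity_pos hg hv s)] at habs
  ext t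
  rw [hY, hZ]
  refine intervalIntegral.integral_congr fun s _ => ?_
  refine congrArg (v + ·) (intervalIntegral.integral_congr fun τ _ => ?_)
  by_cases hτ : τ ∈ Icc 0 T
  · simp only [hIcc hτ]
  · simp only [hg.unfoldedForce_eq_zero hτ]

/-- Continuous dependence of the unfolded solutions on the initial velocity. -/
lemma tendsto (hY : IsUnfoldedSolution r g b Y) (hg : IsRegularForce T g M A) (hr : 0 < r)
    (hb : ∫ s, M s < b) {V : ℕ → ℝ} (hV : Tendsto V atTop (𝓝 b)) {y : ℕ → C(ℝ, ℝ)}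
    (hy : ∀ n, IsUnfoldedSolution r g (V n) (y n)) : Tendsto y atTop (𝓝 Y) := by
  refine tendsto_of_subseq_tendsto fun ns hns => ?_
  obtain ⟨Z, φ, -, hφ, hZ⟩ := hg.exists_subseq_tendsto hr (hV.comp hns) hb
    (U := fun n => y (ns n)) (fun n => (y (ns n)).continuous) (Y := fun n => y (ns n))
    (fun n => hy (ns n)) (fun t _ => by simp)
  exact ⟨φ, hY.eq hZ hg hr hb ▸ hφ⟩

lemma eventually_abs_sub_lt (hY : IsUnfoldedSolution r g b Y) (hg : IsRegularForce T g M A)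
    (hr : 0 < r) (hb : ∫ s, M s < b) {ε : ℝ} (hε : 0 < ε) :
    ∀ᶠ v in 𝓝 b, ∀ Z, IsUnfoldedSolution r g v Z → ∀ t ∈ Icc 0 T, |Z t - Y t| < ε := by
  by_contra hcon
  obtain ⟨V, hV, hbad⟩ := exists_seq_forall_of_frequently (not_eventually.1 hcon)
  push Not at hbad
  choose y hy t ht hty using hbad
  have hunif := (ContinuousMap.tendsto_iff_forall_isCompact_tendstoUniformlyOn.1
    (hY.tendsto hg hr hb hV hy)) _ (isCompact_Icc (a := 0) (b := T))
  obtain ⟨n, hn⟩ := (Metric.tendstoUniformlyOn_iff.1 hunif ε hε).exists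
  have := hn (t n) (ht n)
  rw [dist_comm, Real.dist_eq] at this
  exact (hty n).not_gt this

/-! ### Impact times -/

/-- The `i`-th impact is the crossing of the odd multiple `(2i - 1)r` by the unfolded solution. -/
lemma exists_hasImpactTimes (hY : IsUnfoldedSolution r g v Y) (hg : IsRegularForce T g M A)
    (hr : 0 < r) (hT : 0 ≤ T) (hv : ∫ s, M s < v) :
    ∃ (k : ℕ) (t : ℕ → ℝ), HasImpactTimes r T (fun t => fold r (Y t)) k t ∧
      (∀ i ∈ Icc 1 k, t i ∈ Icc 0 T ∧ Y (t i) = 2 * r * i - r) ∧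
      2 * r * k - r ≤ Y T ∧ Y T < 2 * r * k + r := by
  have hmono := hY.strictMono hg hv
  have h0 := hY.map_zero
  have hYT : 0 ≤ Y T := h0 ▸ hmono.monotone hT
  have hdiv : (Y T + r) / (2 * r) * (2 * r) = Y T + r := div_mul_cancel₀ _ (by positivity)
  -- The number of positive odd multiples of `r` that do not exceed `Y T`.
  set k := ⌊(Y T + r) / (2 * r)⌋₊ with hk
  have hle : 2 * r * k - r ≤ Y T := by
    have := Nat.floor_le (a := (Y T + r) / (2 * r)) (by positivity)
    nlinarith
  have hlt : Y T < 2 * r * k + r := by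
    have := Nat.lt_floor_add_one ((Y T + r) / (2 * r))
    nlinarith
  have hcross : ∀ i ∈ Icc 1 k, ∃ t ∈ Icc 0 T, Y t = 2 * r * i - r := by
    intro i hi
    have h1 : (1 : ℝ) ≤ i := by exact_mod_cast hi.1
    have h2 : (i : ℝ) ≤ k := by exact_mod_cast hi.2
    exact intermediate_value_Icc hT Y.continuous.continuousOn
      ⟨by rw [h0]; nlinarith, by nlinarith⟩
  choose! t ht hYt using hcross
  refine ⟨k, t, ⟨fun i hi j hj hij => ?_, ?_⟩, fun i hi => ⟨ht i hi, hYt i hi⟩, hle, hlt⟩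
  · rw [← hmono.lt_iff_lt, hYt i hi, hYt j hj]
    have : (i : ℝ) < j := by exact_mod_cast hij
    nlinarith
  · ext s
    constructor
    · rintro ⟨i, hi, rfl⟩
      exact ⟨ht i hi, (abs_eq hr.le).1 ((abs_fold_eq_iff hr _).2 ⟨i, by simpa using hYt i hi⟩)⟩
    · rintro ⟨hs, hs'⟩
      obtain ⟨n, hn⟩ := (abs_fold_eq_iff hr _).1 ((abs_eq hr.le).2 hs')
      have h1 : 0 ≤ Y s := h0 ▸ hmono.monotone hs.1
      have h2 : Y s ≤ Y T := hmono.monotone hs.2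
      have hn0 : (0 : ℝ) < n := by
        by_contra! hcon
        nlinarith
      have hnk : (n : ℝ) < k + 1 := by
        by_contra! hcon
        nlinarith
      have hn0' : 0 < n := by exact_mod_cast hn0
      lift n to ℕ using hn0'.le
      have hi : n ∈ Icc 1 k := ⟨by exact_mod_cast hn0', by
        have : (n : ℝ) < k + 1 := by exact_mod_cast hnk
        exact Nat.lt_succ_iff.1 (by exact_mod_cast this)⟩
      exact ⟨n, hi, hmono.injective (by rw [hYt n hi, hn]; norm_cast)⟩

end IsUnfoldedSolution

lemma HasImpactTimes.congr {r T : ℝ} {x z : ℝ → ℝ} {k : ℕ} {t : ℕ → ℝ}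
    (h : HasImpactTimes r T x k t) (hzx : EqOn z x (Icc 0 T)) : HasImpactTimes r T z k t := by
  refine ⟨h.1, h.2.trans ?_⟩
  ext s
  refine and_congr_right fun hs => ?_
  rw [hzx hs]

/-- Write `s i` as `t j`. If `j < i`, then `s j = t j = s i` contradicts injectivity; so `i ≤ j`. -/
lemma StrictMonoOn.le_of_image_eq {k l : ℕ} {s t : ℕ → ℝ} (hs : StrictMonoOn s (Icc 1 k))
    (himage : s '' Icc 1 k = t '' Icc 1 l) {i : ℕ} (hi : i ∈ Icc 1 k) (hi' : i ∈ Icc 1 l)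
    (ht : StrictMonoOn t (Icc 1 l)) (h : ∀ j < i, j ∈ Icc 1 k → s j = t j) : t i ≤ s i := by
  obtain ⟨j, hj, hji⟩ := himage.subset (mem_image_of_mem s hi)
  rw [← hji]
  rcases le_or_gt i j with hij | hij
  · exact ht.monotoneOn hi' hj hij
  · have hjk : j ∈ Icc 1 k := ⟨hj.1, hij.le.trans hi.2⟩
    exact absurd (hs.injOn hjk hi ((h j hij hjk).trans hji)) hij.ne

/-- The enumeration of the impact times is unique. -/
lemma HasImpactTimes.unique {r T : ℝ} {x : ℝ → ℝ} {k l : ℕ} {s t : ℕ → ℝ}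
    (hs : HasImpactTimes r T x k s) (ht : HasImpactTimes r T x l t) :
    k = l ∧ ∀ i ∈ Icc 1 k, s i = t i := by
  have himage : s '' Icc 1 k = t '' Icc 1 l := hs.2.trans ht.2.symm
  have hkl : k = l := by
    have h1 := hs.1.injOn.ncard_image
    have h2 := ht.1.injOn.ncard_image
    rw [himage, h2] at h1
    simpa [← Finset.coe_Icc] using h1.symm
  subst hkl
  refine ⟨rfl, fun i => ?_⟩
  induction i using Nat.strong_induction_on with
  | _ i ih =>
    intro hi
    exact le_antisymm
      (ht.1.le_of_image_eq himage.symm hi hi hs.1 fun j hj hj' => (ih j hj hj').symm)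
      (hs.1.le_of_image_eq himage hi hi ht.1 fun j hj hj' => ih j hj hj')

namespace IsUnfoldedSolution

variable {r T v b : ℝ} {g : ℝ → ℝ → ℝ} {M A : ℝ → ℝ} {Y Z : C(ℝ, ℝ)}

/-- Continuous dependence of the impact times on the initial velocity. -/
lemma eventually_exists_hasImpactTimes (hY : IsUnfoldedSolution r g b Y)
    (hg : IsRegularForce T g M A) (hr : 0 < r) (hT : 0 ≤ T) (hb : ∫ s, M s < b) {k : ℕ}
    {t : ℕ → ℝ} (ht : HasImpactTimes r T (fun t => fold r (Y t)) k t) {η : ℝ} (hη : 0 < η) :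
    ∀ᶠ v in 𝓝 b, ∀ Z, IsUnfoldedSolution r g v Z →
      ∃ (j : ℕ) (s : ℕ → ℝ), HasImpactTimes r T (fun t => fold r (Z t)) j s ∧
        (j = k ∨ |fold r (Y T)| = r ∧ j + 1 = k) ∧ ∀ i ∈ Icc 1 j, |s i - t i| < η := by
  obtain ⟨k', t', ht', hYt, hle, hlt⟩ := hY.exists_hasImpactTimes hg hr hT hb
  obtain ⟨rfl, htt⟩ := ht.unique ht'
  -- The four bounds on `ε` serve, in order: to keep impact times within `η`, since `Y` grows at
  -- rate at least `b - ∫ M`; to lose at most one impact when `Y T` is itself a crossing; to gain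
  -- none; and to lose none when the last crossing is strictly before `T`.
  obtain ⟨ε, hε, hεη, hεr, hεlt, hεle⟩ : ∃ ε > 0, ε ≤ (b - ∫ s, M s) * η ∧ ε ≤ r ∧
      ε ≤ 2 * r * k + r - Y T ∧ (2 * r * k - r < Y T → ε ≤ Y T - (2 * r * k - r)) := by
    have h1 : 0 < (b - ∫ s, M s) * η := mul_pos (by linarith) hη
    have h2 : 0 < min (min ((b - ∫ s, M s) * η) r) (2 * r * k + r - Y T) :=
      lt_min (lt_min h1 hr) (by linarith)
    have hmin : ∀ a, min a (min (min ((b - ∫ s, M s) * η) r) (2 * r * k + r - Y T)) ≤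
        min (min ((b - ∫ s, M s) * η) r) (2 * r * k + r - Y T) := fun a => min_le_right _ _
    by_cases h3 : 2 * r * k - r < Y T
    · refine ⟨min (Y T - (2 * r * k - r)) (min (min ((b - ∫ s, M s) * η) r) (2 * r * k + r - Y T)),
        lt_min (by linarith) h2, (hmin _).trans ((min_le_left _ _).trans (min_le_left _ _)),
        (hmin _).trans ((min_le_left _ _).trans (min_le_right _ _)),
        (hmin _).trans (min_le_right _ _), fun _ => min_le_left _ _⟩
    · exact ⟨_, h2, (min_le_left _ _).trans (min_le_left _ _),
        (min_le_left _ _).trans (min_le_right _ _), min_le_right _ _, fun h => absurd h h3⟩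
  filter_upwards [hY.eventually_abs_sub_lt hg hr hb hε, lt_mem_nhds hb] with v hvε hv Z hZ
  obtain ⟨j, s, hs, hZs, hjle, hjlt⟩ := hZ.exists_hasImpactTimes hg hr hT hv
  have hclose := hvε Z hZ
  have hT' := abs_lt.1 (hclose T ⟨hT, le_rfl⟩)
  have hjk : j ≤ k := by
    have : (j : ℝ) < k + 1 := by
      by_contra! hcon
      nlinarith
    exact Nat.lt_succ_iff.1 (by exact_mod_cast this)
  refine ⟨j, s, hs, ?_, fun i hi => ?_⟩
  · rcases hle.eq_or_lt with heq | hlt'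
    · have hkj : k ≤ j + 1 := by
        have : (k : ℝ) < j + 2 := by
          by_contra! hcon
          nlinarith
        exact Nat.lt_succ_iff.1 (by exact_mod_cast this)
      rcases hjk.eq_or_lt with h | h
      · exact Or.inl h
      · exact Or.inr ⟨(abs_fold_eq_iff hr _).2 ⟨k, by simpa using heq.symm⟩, by omega⟩
    · have hkj : k ≤ j := by
        have h1 := hεle hlt'
        have : (k : ℝ) < j + 1 := by
          by_contra! hcon
          nlinarith
        exact Nat.lt_succ_iff.1 (by exact_mod_cast this)
      exact Or.inl (le_antisymm hjk hkj)
  · have hik : i ∈ Icc 1 k := ⟨hi.1, hi.2.trans hjk⟩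
    rw [htt i hik]
    obtain ⟨hsT, hZsi⟩ := hZs i hi
    obtain ⟨-, hYti⟩ := hYt i hik
    have h1 := abs_lt.1 (hclose (s i) hsT)
    -- Both paths cross the same level at their `i`-th impacts, so `Y` at the two times differs by
    -- less than `ε`.
    rw [hZsi, ← hYti] at h1
    have hc : 0 < b - ∫ s, M s := by linarith
    refine lt_of_mul_lt_mul_left ?_ hc.le
    rcases le_total (s i) (t' i) with h | h
    · have := hY.mul_sub_le hg h
      rw [abs_of_nonpos (by linarith), neg_sub]
      linarith
    · have := hY.mul_sub_le hg h
      rw [abs_of_nonneg (by linarith)]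
      linarith

end IsUnfoldedSolution

theorem mainTheorem2 (r T : ℝ) (hr : 0 < r) (hT : 0 < T)
    (f : ℝ → ℝ → ℝ) (m α : ℝ → ℝ)
    (hf : IsIntegrablyBoundedCaratheodory T f m) (hL : IsIntegrablyLipschitz T f α)
    (b : ℝ) (hb : (∫ t in (0)..T, |m t|) < b) :
    -- well-posedness for every initial velocity `v > ‖m‖₁`
    (∀ v : ℝ, (∫ t in (0)..T, |m t|) < v →
      ∃ y : ℝ → ℝ, IsBilliardSolution r T f v y ∧
        ∀ z : ℝ → ℝ, IsBilliardSolution r T f v z → EqOn z y (Icc 0 T)) ∧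
    -- `x v` is the solution with initial velocity `v`
    ∀ x : ℝ → ℝ → ℝ,
      (∀ v : ℝ, (∫ t in (0)..T, |m t|) < v → IsBilliardSolution r T f v (x v)) →
      -- the endpoint map is continuous at `b`
      ContinuousAt (fun v => x v T) b ∧
      -- there are finitely many impacts
      (∃ (k : ℕ) (t : ℕ → ℝ), HasImpactTimes r T (x b) k t) ∧
      -- the impact times depend continuously on the initial velocity; an impact at the final
      -- time `T` may disappear
      ∀ (k : ℕ) (t : ℕ → ℝ), HasImpactTimes r T (x b) k t →
        ∀ η > 0, ∃ δ > 0, ∀ v : ℝ, |v - b| < δ →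
          ∃ (j : ℕ) (s : ℕ → ℝ), HasImpactTimes r T (x v) j s ∧
            (j = k ∨ (x b T = r ∨ x b T = -r) ∧ j + 1 = k) ∧
            ∀ i ∈ Icc 1 j, |s i - t i| < η := by
  obtain ⟨g, A, hg, hfg⟩ := exists_isRegularForce hf hL
  have hM : ∫ s, (Icc 0 T).indicator (fun t => |m t|) s = ∫ t in (0)..T, |m t| := by
    rw [integral_indicator measurableSet_Icc, integral_Icc_eq_integral_Ioc,
      intervalIntegral.integral_of_le hT.le]
  rw [← hM] at hb ⊢
  have hex := fun v (hv : _ < v) => hg.exists_isUnfoldedSolution (v := v) hr hv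
  refine ⟨fun v hv => ?_, fun x hx => ?_⟩
  · obtain ⟨Y, hY⟩ := hex v hv
    exact ⟨fun t => fold r (Y t), hY.isBilliardSolution hg hr hv hfg,
      fun z hz => hY.eqOn_fold_comp hg hr hv hfg hz⟩
  obtain ⟨Y, hY⟩ := hex b hb
  have hxY : ∀ v, _ < v → ∀ Z, IsUnfoldedSolution r g v Z →
      EqOn (x v) (fun t => fold r (Z t)) (Icc 0 T) := fun v hv Z hZ =>
    hZ.eqOn_fold_comp hg hr hv hfg (hx v hv)
  have hTmem : T ∈ Icc 0 T := ⟨hT.le, le_rfl⟩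
  refine ⟨?_, ?_, fun k t ht η hη => ?_⟩
  · rw [Metric.continuousAt_iff']
    intro ε hε
    obtain ⟨δ, hδ, hfold⟩ := Metric.continuousAt_iff.1 (continuous_fold r).continuousAt ε hε
    filter_upwards [hY.eventually_abs_sub_lt hg hr hb hδ, lt_mem_nhds hb] with v hvδ hv
    obtain ⟨Z, hZ⟩ := hex v hv
    rw [hxY v hv Z hZ hTmem, hxY b hb Y hY hTmem]
    exact hfold (hvδ Z hZ T hTmem)
  · obtain ⟨k, t, ht, -⟩ := hY.exists_hasImpactTimes hg hr hT.le hb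
    exact ⟨k, t, ht.congr (hxY b hb Y hY)⟩
  · have ht' := ht.congr (hxY b hb Y hY).symm
    obtain ⟨δ, hδ, h⟩ := Metric.eventually_nhds_iff.1
      ((hY.eventually_exists_hasImpactTimes hg hr hT.le hb ht' hη).and (lt_mem_nhds hb))
    refine ⟨δ, hδ, fun v hv => ?_⟩
    obtain ⟨h1, h2⟩ := h hv
    obtain ⟨Z, hZ⟩ := hex v h2
    obtain ⟨j, s, hs, hjk, hst⟩ := h1 Z hZ
    refine ⟨j, s, hs.congr (hxY v h2 Z hZ), ?_, hst⟩
    rwa [hxY b hb Y hY hTmem, ← abs_eq hr.le]
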